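/- Identify, as usual, the mapping class group of the closed torus $\mathbb{R}^2/\mathbb{Z}^2$ with $\mathrm{SL}_2(\mathbb{Z})$, the unoriented essential simple closed curves on it (up to isotopy) with the pairs $(p,q)$ of coprime integers up to sign, and the multicurve consisting of $n\ge 1$ parallel copies of the curve $\pm(p,q)$ with the integer vector $\pm(np,nq)$; every non-empty multicurve is of this form, and $\mathrm{SL}_2(\mathbb{Z})$ acts by $g\cdot(\pm v)=\pm(gv)$. Let $D_0$ be a non-empty multicurve, that is, a non-zero element of $\mathbb{Z}^2/\{\pm 1\}$, and let $X=\mathrm{SL}_2(\mathbb{Z})\cdot D_0$ be its orbit. Then $X$ is the set of all multicurves with the same number of components as $D_0$; in particular, if $D_0$ is a single curve, $X$ is the set of all primitive integer vectors up to sign. Moreover, for every integer $k\ge 0$ there is an almost invariant coloring of $X$ using $2^k$ colors, each of them infinitely often: a map $c\colon X\to C$ with $|C|=2^k$ such that, for each $g\in\mathrm{SL}_2(\mathbb{Z})$, $c(x)=c(gx)$ fails for only finitely many $x\in X$, and such that $c^{-1}(z)$ is infinite for every $z\in C$. -/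

import Mathlib

open scoped MatrixGroups

/-- A coloring `c : X → C` of a `G`-set `X` is almost invariant if, for each `g : G`, the identity
`c x = c (g • x)` fails for only finitely many `x`. -/
def IsAlmostInvariant (G : Type*) {X C : Type*} [Group G] [MulAction G X] (c : X → C) : Prop :=
  ∀ g : G, {x : X | c x ≠ c (g • x)}.Finite

/-- Two integer vectors are identified when they agree up to sign. -/
def signSetoid : Setoid (Fin 2 → ℤ) where
  r v w := w = v ∨ w = -v
  iseqv :=
    { refl := fun _ => Or.inl rfl
      symm := by
        rintro v w (h | h)
        · exact Or.inl h.symm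
        · exact Or.inr (by rw [h, neg_neg])
      trans := by
        rintro u v w (h | h) (h' | h')
        · exact Or.inl (h'.trans h)
        · exact Or.inr (by rw [h', h])
        · exact Or.inr (by rw [h', h])
        · exact Or.inl (by rw [h', h, neg_neg]) }

/-- Isotopy classes of multicurves on the closed torus `ℝ² / ℤ²`. A multicurve consists of `n ≥ 0`
parallel copies of one unoriented essential simple closed curve, and such a curve is given by a
pair `(p, q)` of coprime integers up to sign; the multicurve is recorded as the integer vector
`(n p, n q)` up to sign. The zero vector is the empty multicurve. -/
def TorusMulticurve : Type :=
  Quotient signSetoid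

namespace TorusMulticurve

/-- The multicurve given by an integer vector. -/
def mk (v : Fin 2 → ℤ) : TorusMulticurve :=
  Quotient.mk signSetoid v

/-- The empty multicurve. -/
def empty : TorusMulticurve :=
  mk 0

/-- The number of components of a multicurve: the number `n` in `± (n p, n q)`, `p` and `q`
coprime. The multicurves with one component are the primitive integer vectors up to sign. -/
def numComponents (D : TorusMulticurve) : ℕ :=
  Quotient.liftOn D (fun v => Int.gcd (v 0) (v 1)) (by
    rintro v w (h | h) <;> simp [h])

/-- The action of the mapping class group `SL(2, ℤ)` of the closed torus on multicurves, induced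
by the usual action of `SL(2, ℤ)` on integer column vectors. -/
instance : MulAction SL(2, ℤ) TorusMulticurve where
  smul g D := Quotient.liftOn D
    (fun v => mk ((g : Matrix (Fin 2) (Fin 2) ℤ).mulVec v)) (by
      rintro v w (h | h)
      · rw [h]
      · exact Quotient.sound (Or.inr (by rw [h, Matrix.mulVec_neg])))
  one_smul D := by
    refine Quotient.inductionOn D fun v => Quotient.sound (Or.inl ?_)
    rw [Matrix.SpecialLinearGroup.coe_one, Matrix.one_mulVec]
  mul_smul g h D := by
    refine Quotient.inductionOn D fun v => Quotient.sound (Or.inl ?_)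
    rw [Matrix.SpecialLinearGroup.coe_mul, Matrix.mulVec_mulVec]

end TorusMulticurve

/-!
The orbit of a multicurve is computed by Bézout: a vector with `gcd` equal to `n` is `n` times the
first column of a matrix in `SL(2, ℤ)`, and the action preserves the `gcd` of the entries.

The coloring is read off from the Euclidean algorithm. For `v = ± (p, q)` run the algorithm on
`|p|` and `|q|` and keep the last quotient `Nat.lastQuotient`. The generator `S` only swaps `|p|`
and `|q|`, and the last quotient is symmetric. The generator `T` replaces `p` by `p + q`, which
amounts to one or two subtractive Euclidean steps; such a step changes the last quotient only if it
takes place within the last division, where the larger entry is a multiple of the smaller one, and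
then it changes the quotient by one (`Nat.lastQuotient_self_add`). Among vectors with a given
`gcd` this still happens infinitely often, but always with large quotients, up to finitely many
exceptions. Merging all large quotients into one color therefore gives a coloring on which `S` and
`T` act with finitely many failures (`Nat.add_le_of_quotientColor_ne`,
`TorusMulticurve.natAbs_add_le_of_quotientColor_ne`). The elements `g` with finitely many failures
form a subgroup, and `S`, `T` generate `SL(2, ℤ)`. Each quotient `a ≥ 2` occurs infinitely often,
since `(a, t a + 1)` has last quotient `a` for every `t`.
-/

/-! ### The last quotient of the Euclidean algorithm -/

/-- The last quotient in the Euclidean algorithm for `a` and `b`, that is, the quotient of the first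
division without remainder. It is `0` if `a = 0` or `b = 0`. -/
def Nat.lastQuotient : ℕ → ℕ → ℕ
  | 0, _ => 0
  | a + 1, b => if b % (a + 1) = 0 then b / (a + 1) else Nat.lastQuotient (b % (a + 1)) (a + 1)
termination_by a _ => a
decreasing_by exact Nat.mod_lt _ (Nat.succ_pos _)

namespace Nat

theorem lastQuotient_zero_left (b : ℕ) : lastQuotient 0 b = 0 := by
  rw [lastQuotient]

theorem lastQuotient_mul_self {a : ℕ} (ha : 0 < a) (m : ℕ) : lastQuotient a (a * m) = m := by
  obtain ⟨a, rfl⟩ := Nat.exists_eq_succ_of_ne_zero ha.ne'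
  rw [lastQuotient, if_pos (Nat.mul_mod_right _ _), Nat.mul_div_cancel_left _ ha]

theorem lastQuotient_of_not_dvd {a b : ℕ} (ha : 0 < a) (h : ¬ a ∣ b) :
    lastQuotient a b = lastQuotient (b % a) a := by
  obtain ⟨a, rfl⟩ := Nat.exists_eq_succ_of_ne_zero ha.ne'
  rw [lastQuotient, if_neg fun h' => h (Nat.dvd_of_mod_eq_zero h')]

theorem lastQuotient_zero_right (a : ℕ) : lastQuotient a 0 = 0 := by
  rcases Nat.eq_zero_or_pos a with rfl | ha
  · exact lastQuotient_zero_left 0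
  · simpa using lastQuotient_mul_self ha 0

theorem lastQuotient_comm (a b : ℕ) : lastQuotient a b = lastQuotient b a := by
  -- If the first argument is the larger one, then the first division just swaps the arguments.
  have key : ∀ a b : ℕ, a < b → lastQuotient b a = lastQuotient a b := by
    intro a b h
    rcases Nat.eq_zero_or_pos a with rfl | ha
    · rw [lastQuotient_zero_left, lastQuotient_zero_right]
    · rw [lastQuotient_of_not_dvd (ha.trans h) (Nat.not_dvd_of_pos_of_lt ha h),
        Nat.mod_eq_of_lt h]
  rcases lt_trichotomy a b with h | rfl | h
  · exact (key a b h).symm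
  · rfl
  · exact key b a h

/-- A subtractive step outside the last division of the Euclidean algorithm keeps the last
quotient. -/
theorem lastQuotient_self_add {a b : ℕ} (h : ¬ a ∣ b) :
    lastQuotient a (a + b) = lastQuotient a b := by
  rcases Nat.eq_zero_or_pos a with rfl | ha
  · simp [lastQuotient_zero_left]
  · rw [lastQuotient_of_not_dvd ha h,
      lastQuotient_of_not_dvd ha fun h' => h ((Nat.dvd_add_right (dvd_refl a)).1 h'),
      Nat.add_mod_left]

/-- The color of a pair with values in `{0, …, K - 1}`: the quotients `2, …, K + 1` get the colors
`0, …, K - 1`, and all larger ones get the color `0`. The count starts at `2` because the last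
quotient is `0` or `1` only for pairs with a zero entry or with equal entries. -/
def quotientColor (K a b : ℕ) : ℕ :=
  if lastQuotient a b - 2 < K then lastQuotient a b - 2 else 0

theorem quotientColor_comm (K a b : ℕ) : quotientColor K a b = quotientColor K b a := by
  rw [quotientColor, quotientColor, lastQuotient_comm]

theorem quotientColor_lt {K : ℕ} (hK : 0 < K) (a b : ℕ) : quotientColor K a b < K := by
  unfold quotientColor
  split_ifs with h
  exacts [h, hK]

/-- A subtractive step changes the color of only finitely many pairs with a given `gcd`. -/
theorem add_le_of_quotientColor_ne {K a b : ℕ}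
    (h : quotientColor K a (a + b) ≠ quotientColor K a b) : a + b ≤ (K + 2) * a.gcd b := by
  rcases Nat.eq_zero_or_pos a with rfl | ha
  · simp at h
  by_cases hab : a ∣ b
  · obtain ⟨m, rfl⟩ := hab
    have hm : m < K + 2 := by
      by_contra hm
      apply h
      unfold quotientColor
      rw [show a + a * m = a * (m + 1) by ring, lastQuotient_mul_self ha,
        lastQuotient_mul_self ha, if_neg (by omega), if_neg (by omega)]
    rw [Nat.gcd_mul_right_right]
    nlinarith
  · exact absurd (by rw [quotientColor, quotientColor, lastQuotient_self_add hab]) h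

theorem quotientColor_mul_add {K n i : ℕ} (hn : 0 < n) (hi : i < K) (t : ℕ) :
    quotientColor K (n * (i + 2)) (n * (t * (i + 2) + 1)) = i := by
  have hmod : n * (t * (i + 2) + 1) % (n * (i + 2)) = n := by
    rw [Nat.mul_mod_mul_left, Nat.mul_add_mod_self_right, Nat.mod_eq_of_lt (by omega), mul_one]
  have hdvd : ¬ n * (i + 2) ∣ n * (t * (i + 2) + 1) := fun h => by
    rw [Nat.mod_eq_zero_of_dvd h] at hmod
    exact hn.ne hmod
  have hlast : lastQuotient (n * (i + 2)) (n * (t * (i + 2) + 1)) = i + 2 := by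
    rw [lastQuotient_of_not_dvd (by positivity) hdvd, hmod, lastQuotient_mul_self hn]
  rw [quotientColor, hlast, if_pos (by omega), Nat.add_sub_cancel]

end Nat

/-! ### Almost invariant colorings and generators -/

/-- Almost invariance need only be checked on a generating set. -/
theorem IsAlmostInvariant.of_closure_eq_top {G X C : Type*} [Group G] [MulAction G X] {c : X → C}
    {s : Set G} (hs : Subgroup.closure s = ⊤)
    (h : ∀ g ∈ s, {x : X | c x ≠ c (g • x)}.Finite) : IsAlmostInvariant G c := by
  intro g
  have hg : g ∈ Subgroup.closure s := hs ▸ Subgroup.mem_top g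
  induction hg using Subgroup.closure_induction with
  | mem g hg => exact h g hg
  | one => simp
  | mul g₁ g₂ _ _ h₁ h₂ =>
    refine (h₂.union (h₁.preimage (MulAction.injective g₂).injOn)).subset fun x hx => ?_
    by_contra hx'
    simp only [Set.mem_union, Set.mem_preimage, Set.mem_ofPred_eq, not_or, not_not] at hx'
    exact hx (by rw [hx'.1, hx'.2, mul_smul])
  | inv g _ h₁ =>
    refine (h₁.preimage (MulAction.injective g⁻¹).injOn).subset fun x hx => ?_
    simp only [Set.mem_preimage, Set.mem_ofPred_eq, smul_inv_smul] at hx ⊢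
    exact hx.symm

namespace TorusMulticurve

/-! ### Orbits of multicurves -/

theorem smul_mk (g : SL(2, ℤ)) (v : Fin 2 → ℤ) :
    g • mk v = mk ((g : Matrix (Fin 2) (Fin 2) ℤ).mulVec v) :=
  rfl

theorem numComponents_mk (v : Fin 2 → ℤ) : (mk v).numComponents = Int.gcd (v 0) (v 1) :=
  rfl

theorem numComponents_dvd_smul (g : SL(2, ℤ)) (D : TorusMulticurve) :
    D.numComponents ∣ (g • D).numComponents := by
  refine Quotient.inductionOn D fun v => ?_
  change (mk v).numComponents ∣ (g • mk v).numComponents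
  rw [smul_mk, numComponents_mk, numComponents_mk]
  refine Int.dvd_gcd ?_ ?_ <;> rw [Matrix.mulVec_eq_sum] <;>
    simp only [Fin.sum_univ_two, Pi.add_apply, Pi.smul_apply, op_smul_eq_smul, smul_eq_mul] <;>
    exact dvd_add ((Int.gcd_dvd_left _ _).mul_right _) ((Int.gcd_dvd_right _ _).mul_right _)

theorem numComponents_smul (g : SL(2, ℤ)) (D : TorusMulticurve) :
    (g • D).numComponents = D.numComponents := by
  refine Nat.dvd_antisymm ?_ (numComponents_dvd_smul g D)
  simpa using numComponents_dvd_smul g⁻¹ (g • D)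

theorem exists_smul_eq (D : TorusMulticurve) :
    ∃ g : SL(2, ℤ), g • mk ![(D.numComponents : ℤ), 0] = D := by
  refine Quotient.inductionOn D fun v => ?_
  change ∃ g : SL(2, ℤ), g • mk ![((mk v).numComponents : ℤ), 0] = mk v
  rw [numComponents_mk]
  rcases Nat.eq_zero_or_pos (Int.gcd (v 0) (v 1)) with h0 | hpos
  · refine ⟨1, ?_⟩
    rw [one_smul, h0]
    congr 1
    obtain ⟨h, h'⟩ := Int.gcd_eq_zero_iff.1 h0
    ext i
    fin_cases i <;> simp [h, h']
  · obtain ⟨p, q, hpq, hp, hq⟩ := Int.exists_gcd_one hpos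
    obtain ⟨g, hg₀, hg₁⟩ := (Int.isCoprime_iff_gcd_eq_one.2 hpq).exists_SL2_col 0
    refine ⟨g, ?_⟩
    rw [smul_mk]
    congr 1
    ext i
    fin_cases i
    · simpa [Matrix.mulVec, dotProduct, hg₀] using hp.symm
    · simpa [Matrix.mulVec, dotProduct, hg₁] using hq.symm

theorem mem_orbit_iff (D D₀ : TorusMulticurve) :
    D ∈ MulAction.orbit SL(2, ℤ) D₀ ↔ D.numComponents = D₀.numComponents := by
  constructor
  · rintro ⟨g, rfl⟩
    exact numComponents_smul g D₀
  · intro h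
    obtain ⟨g, hg⟩ := exists_smul_eq D
    obtain ⟨g₀, hg₀⟩ := exists_smul_eq D₀
    refine ⟨g * g₀⁻¹, ?_⟩
    change (g * g₀⁻¹) • D₀ = D
    rw [mul_smul, inv_smul_eq_iff.2 hg₀.symm, ← h, hg]

theorem numComponents_pos {D : TorusMulticurve} (hD : D ≠ empty) : 0 < D.numComponents := by
  refine Nat.pos_of_ne_zero fun h => hD ?_
  obtain ⟨g, hg⟩ := exists_smul_eq D
  rw [← hg, h, smul_mk, empty]
  congr 1
  ext i
  simp [Matrix.mulVec, dotProduct]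

theorem finite_setOf_mk_natAbs_add_le (N : ℕ) :
    {D | ∃ v : Fin 2 → ℤ, mk v = D ∧ (v 0).natAbs + (v 1).natAbs ≤ N}.Finite := by
  refine ((Set.finite_Icc (fun _ : Fin 2 => -(N : ℤ)) fun _ => (N : ℤ)).image mk).subset ?_
  rintro D ⟨v, rfl, hv⟩
  refine ⟨v, ⟨fun i => ?_, fun i => ?_⟩, rfl⟩ <;> fin_cases i <;> simp <;> omega

/-! ### The coloring by last quotients -/

/-- The color in `{0, …, K - 1}` of the multicurve `± (p, q)`, given by the last quotient in the
Euclidean algorithm for `|p|` and `|q|`. -/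
def quotientColor (K : ℕ) (D : TorusMulticurve) : ℕ :=
  Quotient.liftOn D (fun v => Nat.quotientColor K (v 0).natAbs (v 1).natAbs) (by
    rintro v w (h | h) <;> simp [h])

theorem quotientColor_mk (K : ℕ) (v : Fin 2 → ℤ) :
    quotientColor K (mk v) = Nat.quotientColor K (v 0).natAbs (v 1).natAbs :=
  rfl

theorem quotientColor_lt {K : ℕ} (hK : 0 < K) (D : TorusMulticurve) : quotientColor K D < K :=
  Quotient.inductionOn D fun _ => Nat.quotientColor_lt hK _ _

theorem quotientColor_S_smul (K : ℕ) (D : TorusMulticurve) :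
    quotientColor K (ModularGroup.S • D) = quotientColor K D := by
  refine Quotient.inductionOn D fun v => ?_
  change quotientColor K (ModularGroup.S • mk v) = quotientColor K (mk v)
  rw [smul_mk, quotientColor_mk, quotientColor_mk, Nat.quotientColor_comm]
  simp [Matrix.mulVec, dotProduct, ModularGroup.S]

/-- Shearing a vector changes the color only if the vector is bounded in terms of its `gcd`. -/
theorem natAbs_add_le_of_quotientColor_ne {K : ℕ} {p q : ℤ}
    (h : Nat.quotientColor K (p + q).natAbs q.natAbs ≠
      Nat.quotientColor K p.natAbs q.natAbs) :
    p.natAbs + q.natAbs ≤ 2 * ((K + 2) * Int.gcd p q) := by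
  rw [Int.gcd_def]
  generalize hx : p.natAbs = x at *
  generalize hy : q.natAbs = y at *
  have hcases : (p + q).natAbs = y + x ∨ (y ≤ x ∧ (p + q).natAbs = x - y) ∨
      (x ≤ y ∧ (p + q).natAbs = y - x) := by omega
  rcases hcases with e | ⟨hle, e⟩ | ⟨hle, e⟩ <;> rw [e] at h
  · rw [Nat.quotientColor_comm, Nat.quotientColor_comm K x] at h
    have := Nat.add_le_of_quotientColor_ne h
    rw [Nat.gcd_comm] at this
    omega
  · obtain ⟨z, rfl⟩ := Nat.exists_eq_add_of_le hle
    rw [Nat.add_sub_cancel_left, Nat.quotientColor_comm, Nat.quotientColor_comm K (y + z)] at h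
    have := Nat.add_le_of_quotientColor_ne h.symm
    rw [Nat.gcd_comm, Nat.gcd_self_add_right]
    omega
  · -- Two subtractive steps: both `(z, x + z)` and `(x, x + z)` reduce to `(x, z)`.
    obtain ⟨z, rfl⟩ := Nat.exists_eq_add_of_le hle
    rw [Nat.add_sub_cancel_left] at h
    rw [Nat.gcd_self_add_right]
    by_cases h₁ : Nat.quotientColor K x (x + z) = Nat.quotientColor K x z
    · rw [h₁, Nat.quotientColor_comm K x z, add_comm x z] at h
      have := Nat.add_le_of_quotientColor_ne h
      rw [Nat.gcd_comm] at this
      omega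
    · have := Nat.add_le_of_quotientColor_ne h₁
      omega

theorem exists_mk_of_quotientColor_T_smul_ne {K : ℕ} {D : TorusMulticurve}
    (h : quotientColor K (ModularGroup.T • D) ≠ quotientColor K D) :
    ∃ v : Fin 2 → ℤ, mk v = D ∧
      (v 0).natAbs + (v 1).natAbs ≤ 2 * ((K + 2) * D.numComponents) := by
  induction D using Quotient.inductionOn with | _ v
  refine ⟨v, rfl, ?_⟩
  change quotientColor K (ModularGroup.T • mk v) ≠ quotientColor K (mk v) at h
  change _ ≤ 2 * ((K + 2) * (mk v).numComponents)
  rw [smul_mk, quotientColor_mk, quotientColor_mk] at h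
  rw [numComponents_mk]
  apply natAbs_add_le_of_quotientColor_ne
  simpa [Matrix.mulVec, dotProduct, ModularGroup.T] using h

theorem isAlmostInvariant_of_val_eq_quotientColor {K : ℕ} {D₀ : TorusMulticurve}
    {c : MulAction.orbit SL(2, ℤ) D₀ → Fin K} (hc : ∀ x, (c x : ℕ) = quotientColor K x) :
    IsAlmostInvariant SL(2, ℤ) c := by
  refine IsAlmostInvariant.of_closure_eq_top SpecialLinearGroup.SL2Z_generators ?_
  rintro g (rfl | rfl)
  · convert Set.finite_empty
    ext x
    simp [Fin.ext_iff, hc, MulAction.orbit.coe_smul, quotientColor_S_smul]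
  · refine ((finite_setOf_mk_natAbs_add_le (2 * ((K + 2) * D₀.numComponents))).preimage
      Subtype.val_injective.injOn).subset fun x hx => ?_
    have hx' : quotientColor K (ModularGroup.T • (x : TorusMulticurve)) ≠ quotientColor K x := by
      intro h
      exact hx (Fin.ext (by rw [hc, hc, MulAction.orbit.coe_smul, h]))
    have := exists_mk_of_quotientColor_T_smul_ne hx'
    rwa [(mem_orbit_iff _ _).1 x.2] at this

theorem infinite_setOf_quotientColor_eq {K i : ℕ} (hi : i < K) {D₀ : TorusMulticurve}
    (hD₀ : D₀ ≠ empty) :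
    {x : MulAction.orbit SL(2, ℤ) D₀ | quotientColor K x = i}.Infinite := by
  have hn := numComponents_pos hD₀
  set n := D₀.numComponents with hn_def
  let w : ℕ → Fin 2 → ℤ := fun t => ![(n * (i + 2) : ℕ), (n * (t * (i + 2) + 1) : ℕ)]
  have hw : ∀ t, mk (w t) ∈ MulAction.orbit SL(2, ℤ) D₀ := by
    intro t
    rw [mem_orbit_iff, numComponents_mk, ← hn_def]
    change Int.gcd ((n * (i + 2) : ℕ) : ℤ) ((n * (t * (i + 2) + 1) : ℕ) : ℤ) = n
    rw [Int.gcd_natCast_natCast, Nat.gcd_mul_left]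
    simp
  refine Set.infinite_of_injective_forall_mem (f := fun t : ℕ => ⟨mk (w t), hw t⟩) ?_ ?_
  · intro t t' h
    have h₁ : n * (t' * (i + 2) + 1) = n * (t * (i + 2) + 1) := by
      rcases Quotient.exact (Subtype.ext_iff.1 h) with h' | h' <;> have h'' := congrFun h' 1
      · exact Int.ofNat_inj.1 h''
      · -- The second entries are positive, so they cannot be opposite.
        have := Nat.mul_pos hn (Nat.succ_pos (t * (i + 2)))
        have e : ((n * (t' * (i + 2) + 1) : ℕ) : ℤ) = -((n * (t * (i + 2) + 1) : ℕ) : ℤ) := h''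
        omega
    have h₂ := Nat.eq_of_mul_eq_mul_left hn h₁
    exact (Nat.eq_of_mul_eq_mul_right (Nat.succ_pos (i + 1)) (Nat.succ_injective h₂)).symm
  · intro t
    change quotientColor K (mk (w t)) = i
    rw [quotientColor_mk]
    exact Nat.quotientColor_mul_add hn hi t

end TorusMulticurve

theorem theorem2 (D₀ : TorusMulticurve) (hD₀ : D₀ ≠ TorusMulticurve.empty) :
    (∀ D : TorusMulticurve,
      D ∈ MulAction.orbit SL(2, ℤ) D₀ ↔ D.numComponents = D₀.numComponents) ∧
    ∀ k : ℕ, ∃ c : MulAction.orbit SL(2, ℤ) D₀ → Fin (2 ^ k),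
      IsAlmostInvariant SL(2, ℤ) c ∧ ∀ i : Fin (2 ^ k), (c ⁻¹' {i}).Infinite := by
  refine ⟨fun D => TorusMulticurve.mem_orbit_iff D D₀, fun k => ?_⟩
  refine ⟨fun x => ⟨TorusMulticurve.quotientColor (2 ^ k) x,
    TorusMulticurve.quotientColor_lt (by positivity) _⟩,
    TorusMulticurve.isAlmostInvariant_of_val_eq_quotientColor fun _ => rfl, fun i => ?_⟩
  convert TorusMulticurve.infinite_setOf_quotientColor_eq i.2 hD₀ using 1
  ext x
  simp [Fin.ext_iff]
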